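/- Let $0<\alpha<1$, $1<\beta<2$, and let $E_{a,b}(z)=\sum_{n=0}^\infty \frac{z^n}{\Gamma(an+b)}$ denote the two-parameter Mittag-Leffler function. Let $g\in L^\infty(0,1)$ be real-valued with $g\ge 0$ almost everywhere, and let $\lambda_1<\lambda_2<\cdots$ be the eigenvalues of the Dirichlet problem $$v''-g\,v=-\lambda v \ \text{ on } (0,1),\qquad 0\neq v\in H^2(0,1),\quad v(0)=v(1)=0 .$$ For $p,q>0$ put $$\tilde\Delta_k=E_{\alpha,1}(-\lambda_k q^\alpha)-\left[E_{\beta,1}(-\lambda_k p^\beta)+\lambda_k\, p\, E_{\beta,2}(-\lambda_k p^\beta)\right].$$ Then for every fixed $p>0$ there is $Q>0$ such that for every $q\ge Q$ there is $\delta>0$ with $|\tilde\Delta_k|>\delta$ for all $k$ (that is, for all eigenvalues $\lambda_k$ of the problem). -/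

import Mathlib

open MeasureTheory Set
open scoped ContDiff

noncomputable section

/-- The two-parameter Mittag-Leffler function
`E_{a,b}(z) = ∑ n, z ^ n / Γ (a n + b)` at a real argument (the series converges for all real `z`
when `a, b > 0`). -/
def mittagLeffler (a b z : ℝ) : ℝ :=
  ∑' n : ℕ, z ^ n / Real.Gamma (a * n + b)

/-- `v'` is a weak (distributional) derivative of `v` on the interval `(0, 1)`. -/
def HasWeakDerivUnit (v v' : ℝ → ℝ) : Prop :=
  ∀ φ : ℝ → ℝ, ContDiff ℝ ∞ φ → HasCompactSupport φ → tsupport φ ⊆ Ioo 0 1 →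
    ∫ x in Ioo (0 : ℝ) 1, v x * deriv φ x = -∫ x in Ioo (0 : ℝ) 1, v' x * φ x

/-- `v ∈ H²(0,1)` with `v(0) = v(1) = 0`, and `v''` is its second weak derivative. An element of
`H²(0,1)` is represented by its continuous representative on `[0, 1]`, so that the boundary
values make sense. -/
def InDirichletDomain (v v'' : ℝ → ℝ) : Prop :=
  ContinuousOn v (Icc 0 1) ∧ v 0 = 0 ∧ v 1 = 0 ∧
    MemLp v'' 2 (volume.restrict (Ioo (0 : ℝ) 1)) ∧
    ∃ v' : ℝ → ℝ, MemLp v' 2 (volume.restrict (Ioo (0 : ℝ) 1)) ∧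
      HasWeakDerivUnit v v' ∧ HasWeakDerivUnit v' v''

/-- The set of numbers `lam` such that `L v = -lam v` for some nonzero `v` in the domain
`H²(0,1) ∩ H¹₀(0,1)` of the operator `L v = v'' - g v` in `L²(0,1)`. -/
def dirichletEigenvalues (g : ℝ → ℝ) : Set ℝ :=
  {lam | ∃ v v'' : ℝ → ℝ, InDirichletDomain v v'' ∧
    (∃ x ∈ Icc (0 : ℝ) 1, v x ≠ 0) ∧
    ∀ᵐ x ∂(volume.restrict (Ioo (0 : ℝ) 1)), v'' x - g x * v x = -lam * v x}

/-- The quantity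
`E_{α,1}(-lam q^α) - [E_{β,1}(-lam p^β) + lam p E_{β,2}(-lam p^β)]`. -/
def deltaTilde (α β p q lam : ℝ) : ℝ :=
  mittagLeffler α 1 (-lam * q ^ α) -
    (mittagLeffler β 1 (-lam * p ^ β) + lam * p * mittagLeffler β 2 (-lam * p ^ β))

end

/-! The argument separates large eigenvalues from the finitely many others. For large `lam` the
bracket, the wave term, tends to the positive number `M = p ^ (1 - β) / Γ(2 - β)`, while
`E_{α,1}(-lam q^α)` is below `M / 4` as soon as `q ^ α` is large, because every eigenvalue is at
least 1. Hence `deltaTilde < -M / 4` beyond some `Λ`, and `Λ` does not depend on `q`. For each of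
the finitely many eigenvalues up to `Λ`, `deltaTilde` is nonzero for all large `q`: if the wave term
is nonzero, the `α`-term tends to 0 and cannot equal it; if it is zero, the `α`-term is nonzero
since it behaves like `1 / (x Γ(1 - α))` with `x = lam q^α`. A minimum over a finite set then gives
`δ`.

Two ingredients carry this. The decay `E_{a,b}(-x) → 0` for `0 < a < 2`
(`tendsto_mittagLeffler_neg_atTop`) follows from a Bromwich integral on `Re s = 1` by dominated
convergence; the shift `E_{a,b-a}(-x) = 1/Γ(b-a) - x E_{a,b}(-x)` turns decay into the leading
asymptotic term. The bound "number of eigenvalues up to `Λ` is at most `Λ`"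
(`card_le_of_subset_dirichletEigenvalues`) follows from orthonormality, the energy identity and `g ≥
0`. -/

/-! ### Holomorphic parameter integrals and the Laplace transform of powers. -/

/-- No bound on the derivative is needed: Cauchy's estimate on a small circle converts the bound on
`F` into one on `∂F/∂z`. -/
theorem differentiableOn_integral_of_dominated {α : Type*} [MeasurableSpace α] {μ : Measure α}
    {F : ℂ → α → ℂ} {U : Set ℂ} (hU : IsOpen U) {bound : α → ℝ} (hb : Integrable bound μ)
    (hmeas : ∀ z ∈ U, AEStronglyMeasurable (F z) μ)
    (hdiff : ∀ a, DifferentiableOn ℂ (F · a) U)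
    (hle : ∀ z ∈ U, ∀ a, ‖F z a‖ ≤ bound a) :
    DifferentiableOn ℂ (fun z => ∫ a, F z a ∂μ) U := by
  intro z₀ hz₀
  obtain ⟨ε, hε, hball⟩ := Metric.isOpen_iff.1 hU z₀ hz₀
  have hsub : ∀ z ∈ Metric.ball z₀ (ε / 2), Metric.closedBall z (ε / 2 / 2) ⊆ Metric.ball z₀ ε := by
    intro z hz w hw
    rw [Metric.mem_ball] at hz ⊢
    rw [Metric.mem_closedBall] at hw
    linarith [dist_triangle w z z₀]
  -- The derivative at `z₀` is measurable in `a` as a limit of difference quotients along a sequence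
  -- tending to 0.
  have hmeas' : AEStronglyMeasurable (fun a => deriv (F · a) z₀) μ := by
    have hn : Filter.Tendsto (fun n : ℕ => (((ε / 2) * (1 / ((n : ℝ) + 1)) : ℝ) : ℂ)) Filter.atTop
        (nhdsWithin 0 {0}ᶜ) := by
      rw [tendsto_nhdsWithin_iff]
      constructor
      · have := (tendsto_one_div_add_atTop_nhds_zero_nat (𝕜 := ℝ)).const_mul (ε / 2)
        rw [mul_zero] at this
        exact_mod_cast (Complex.continuous_ofReal.tendsto 0).comp this
      · refine Filter.Eventually.of_forall fun n => ?_
        have : (ε / 2) * (1 / ((n : ℝ) + 1)) ≠ 0 := by positivity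
        rw [mem_compl_singleton_iff]
        exact Complex.ofReal_ne_zero.2 this
    refine aestronglyMeasurable_of_tendsto_ae Filter.atTop
      (f := fun (n : ℕ) a => ((((ε / 2) * (1 / ((n : ℝ) + 1)) : ℝ) : ℂ))⁻¹ •
        (F (z₀ + (((ε / 2) * (1 / ((n : ℝ) + 1)) : ℝ) : ℂ)) a - F z₀ a)) ?_ ?_
    · intro n
      suffices hU' : z₀ + (((ε / 2) * (1 / ((n : ℝ) + 1)) : ℝ) : ℂ) ∈ U by
        have h := ((hmeas _ hU').sub (hmeas _ hz₀)).const_smul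
          ((((ε / 2) * (1 / ((n : ℝ) + 1)) : ℝ) : ℂ))⁻¹
        exact h
      apply hball
      rw [Metric.mem_ball, dist_eq_norm, add_sub_cancel_left, Complex.norm_real, Real.norm_of_nonneg
        (by positivity)]
      have : 1 / ((n : ℝ) + 1) ≤ 1 := by
        rw [div_le_one (by positivity)]; linarith [n.cast_nonneg (α := ℝ)]
      nlinarith
    · refine Filter.Eventually.of_forall fun a => ?_
      have := ((hdiff a).differentiableAt (hU.mem_nhds hz₀)).hasDerivAt
      rw [hasDerivAt_iff_tendsto_slope_zero] at this
      exact this.comp hn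
  have key := hasDerivAt_integral_of_dominated_loc_of_deriv_le (μ := μ) (F := F)
    (F' := fun z a => deriv (F · a) z) (bound := fun a => bound a / (ε / 2 / 2))
    (Metric.ball_mem_nhds z₀ (half_pos hε))
    (Filter.eventually_of_mem (hU.mem_nhds hz₀) hmeas)
    (hb.mono' (hmeas z₀ hz₀) (Filter.Eventually.of_forall (hle z₀ hz₀))) hmeas' ?_
    (hb.div_const _) ?_
  · exact key.2.differentiableAt.differentiableWithinAt
  · refine Filter.Eventually.of_forall fun a z hz => ?_
    refine Complex.norm_deriv_le_of_forall_mem_sphere_norm_le (by positivity) ?_ ?_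
    · refine ((hdiff a).mono ((hsub z hz).trans hball)).diffContOnCl_ball subset_rfl
    · intro w hw
      exact hle w (hball (hsub z hz (Metric.sphere_subset_closedBall hw))) a
  · refine Filter.Eventually.of_forall fun a z hz => ?_
    exact ((hdiff a).differentiableAt (hU.mem_nhds (hball
      (Metric.ball_subset_ball (by linarith) hz)))).hasDerivAt

/-- The Laplace transform of `t ^ (c - 1)`. -/
theorem integral_rpow_mul_cexp_neg_mul_Ioi {c : ℝ} (hc : 0 < c) {r : ℂ} (hr : 1 / 2 < r.re) :
    ∫ t in Ioi (0 : ℝ), ((t ^ (c - 1) : ℝ) : ℂ) * Complex.exp (-(r * t)) =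
      r ^ (-c : ℂ) * (Real.Gamma c : ℂ) := by
  set U : Set ℂ := {r | 1 / 2 < r.re} with hUdef
  have hUo : IsOpen U := isOpen_lt continuous_const Complex.continuous_re
  have hUc : IsPreconnected U := (convex_halfSpace_re_gt (1 / 2)).isPreconnected
  have hbound : IntegrableOn (fun t : ℝ => t ^ (c - 1) * Real.exp (-(1 / 2) * t)) (Ioi 0) := by
    simpa using integrableOn_rpow_mul_exp_neg_mul_rpow (s := c - 1) (p := 1) (b := 1 / 2)
      (by linarith) (by norm_num) (by norm_num)
  have hL : DifferentiableOn ℂ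
      (fun r : ℂ => ∫ t in Ioi (0 : ℝ), ((t ^ (c - 1) : ℝ) : ℂ) * Complex.exp (-(r * t))) U := by
    -- The indicator makes the domination hold at every `t`, not only on the half-line.
    have := differentiableOn_integral_of_dominated (μ := volume.restrict (Ioi (0 : ℝ)))
      (F := fun r t => (Ioi (0 : ℝ)).indicator
        (fun t => ((t ^ (c - 1) : ℝ) : ℂ) * Complex.exp (-(r * t))) t) hUo
      (bound := (Ioi (0 : ℝ)).indicator (fun t : ℝ => t ^ (c - 1) * Real.exp (-(1 / 2) * t)))
      (hbound.integrable.indicator measurableSet_Ioi) ?_ ?_ ?_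
    · refine this.congr fun z hz => ?_
      exact setIntegral_congr_fun measurableSet_Ioi fun t ht => by simp [indicator_of_mem ht]
    · intro z _
      refine Measurable.aestronglyMeasurable (Measurable.indicator ?_ measurableSet_Ioi)
      fun_prop
    · intro t
      by_cases ht : t ∈ Ioi (0 : ℝ)
      · simp only [indicator_of_mem ht]
        fun_prop
      · simp only [indicator_of_notMem ht]
        fun_prop
    · intro z hz t
      by_cases ht : t ∈ Ioi (0 : ℝ)
      · simp only [indicator_of_mem ht]
        have ht' : 0 < t := ht
        rw [norm_mul, Complex.norm_real, Real.norm_of_nonneg (by positivity), Complex.norm_exp]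
        have hz' : 1 / 2 < z.re := hz
        gcongr
        simp
        nlinarith
      · simp only [indicator_of_notMem ht, norm_zero, le_refl]
  have hR : DifferentiableOn ℂ (fun r : ℂ => r ^ (-c : ℂ) * (Real.Gamma c : ℂ)) U := by
    intro z hz
    have hz' : 1 / 2 < z.re := hz
    refine (DifferentiableAt.mul_const ?_ _).differentiableWithinAt
    exact differentiableAt_id.cpow_const (Or.inl (by simp; linarith))
  -- Identity theorem: the two sides agree at the real points `1 + 1/(n+1)`, which accumulate at 1.
  refine (hL.analyticOnNhd hUo).eqOn_of_preconnected_of_frequently_eq (hR.analyticOnNhd hUo) hUc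
    (z₀ := 1) (by simp [hUdef]; norm_num) ?_ hr
  have hn : Filter.Tendsto (fun n : ℕ => ((1 + 1 / ((n : ℝ) + 1) : ℝ) : ℂ)) Filter.atTop
        (nhdsWithin 1 {1}ᶜ) := by
    rw [tendsto_nhdsWithin_iff]
    constructor
    · have := (tendsto_one_div_add_atTop_nhds_zero_nat (𝕜 := ℝ)).const_add 1
      rw [add_zero] at this
      exact_mod_cast (Complex.continuous_ofReal.tendsto 1).comp this
    · refine Filter.Eventually.of_forall fun n => ?_
      have : 1 + (1 / ((n : ℝ) + 1)) ≠ 1 := by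
        have : 0 < 1 / ((n : ℝ) + 1) := by positivity
        linarith
      rw [mem_compl_singleton_iff, Ne, Complex.ofReal_eq_one]
      exact this
  refine hn.frequently (Filter.Frequently.of_forall fun n => ?_)
  set x : ℝ := 1 + 1 / ((n : ℝ) + 1) with hx
  have hx0 : 0 < x := by positivity
  have := Complex.integral_cpow_mul_exp_neg_mul_Ioi (a := c) (r := x) (by simpa) hx0
  rw [← Complex.Gamma_ofReal]
  convert this using 1
  · refine setIntegral_congr_fun measurableSet_Ioi fun t ht => ?_
    have ht' : (0 : ℝ) ≤ t := (le_of_lt ht)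
    simp only [Complex.ofReal_cpow ht']
    push_cast
    rfl
  · congr 1
    rw [one_div, Complex.inv_cpow, Complex.cpow_neg]
    rw [Complex.arg_ofReal_of_nonneg hx0.le]
    exact Real.pi_pos.ne

/-! ### The Bromwich integral for `1/Γ` and the sector estimate. -/

/-- The vertical line `Re s = 1`, parametrised as in Mathlib's Fourier transform. -/
noncomputable def verticalLineOne (ξ : ℝ) : ℂ := 1 + 2 * Real.pi * ξ * Complex.I

theorem verticalLineOne_re (ξ : ℝ) : (verticalLineOne ξ).re = 1 := by
  simp [verticalLineOne]

theorem verticalLineOne_im (ξ : ℝ) : (verticalLineOne ξ).im = 2 * Real.pi * ξ := by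
  simp [verticalLineOne]

theorem verticalLineOne_ne_zero (ξ : ℝ) : verticalLineOne ξ ≠ 0 := by
  intro h
  have := verticalLineOne_re ξ
  rw [h] at this
  simp at this

theorem one_le_norm_verticalLineOne (ξ : ℝ) : 1 ≤ ‖verticalLineOne ξ‖ := by
  simpa [verticalLineOne_re] using Complex.abs_re_le_norm (verticalLineOne ξ)

theorem verticalLineOne_mem_slitPlane (ξ : ℝ) : verticalLineOne ξ ∈ Complex.slitPlane :=
  Or.inl (by rw [verticalLineOne_re]; exact one_pos)

theorem continuous_verticalLineOne : Continuous verticalLineOne := by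
  unfold verticalLineOne
  fun_prop

theorem continuous_verticalLineOne_cpow (w : ℂ) :
    Continuous fun ξ : ℝ => verticalLineOne ξ ^ w :=
  continuous_verticalLineOne.cpow continuous_const verticalLineOne_mem_slitPlane

theorem norm_cexp_verticalLineOne (ξ : ℝ) :
    ‖Complex.exp (verticalLineOne ξ)‖ = Real.exp 1 := by
  rw [Complex.norm_exp, verticalLineOne_re]

theorem norm_verticalLineOne_cpow (c ξ : ℝ) :
    ‖verticalLineOne ξ ^ (-c : ℂ)‖ = ‖verticalLineOne ξ‖ ^ (-c) := by
  exact_mod_cast Complex.norm_cpow_real (verticalLineOne ξ) (-c)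

theorem norm_verticalLineOne_cpow_le_one {c : ℝ} (hc : 0 ≤ c) (ξ : ℝ) :
    ‖verticalLineOne ξ ^ (-c : ℂ)‖ ≤ 1 := by
  rw [norm_verticalLineOne_cpow]
  exact Real.rpow_le_one_of_one_le_of_nonpos (one_le_norm_verticalLineOne ξ) (by linarith)

theorem integrable_norm_verticalLineOne_rpow {c : ℝ} (hc : 1 < c) :
    Integrable fun ξ : ℝ => ‖verticalLineOne ξ‖ ^ (-c) := by
  refine (integrable_rpow_neg_one_add_norm_sq (E := ℝ) (μ := volume) (r := c) (by simpa)).mono'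
    ?_ (Filter.Eventually.of_forall fun ξ => ?_)
  · exact (continuous_verticalLineOne.norm.rpow_const fun ξ => Or.inl
      (norm_ne_zero_iff.2 (verticalLineOne_ne_zero ξ))).aestronglyMeasurable
  · have h1 : 1 + ‖ξ‖ ^ 2 ≤ ‖verticalLineOne ξ‖ ^ 2 := by
      rw [← Complex.normSq_eq_norm_sq, Complex.normSq_apply, verticalLineOne_re,
        verticalLineOne_im, Real.norm_eq_abs, sq_abs]
      nlinarith [Real.pi_gt_three, sq_nonneg ξ, mul_self_nonneg (2 * Real.pi * ξ),
        mul_nonneg (sq_nonneg ξ) (by nlinarith [Real.pi_gt_three] : 0 ≤ 4 * Real.pi ^ 2 - 1)]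
    rw [Real.norm_of_nonneg (by positivity)]
    have h2 : ‖verticalLineOne ξ‖ ^ (-c) = (‖verticalLineOne ξ‖ ^ 2) ^ (-c / 2) := by
      rw [← Real.rpow_natCast, ← Real.rpow_mul (norm_nonneg _)]
      congr 1
      push_cast
      ring
    rw [h2]
    exact Real.rpow_le_rpow_of_nonpos (by positivity) h1 (by linarith)

/-- The reciprocal Gamma function as a Bromwich integral. -/
theorem integral_cexp_mul_verticalLineOne_cpow {c : ℝ} (hc : 1 < c) :
    ∫ ξ : ℝ, Complex.exp (verticalLineOne ξ) * verticalLineOne ξ ^ (-c : ℂ) =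
      ((Real.Gamma c)⁻¹ : ℝ) := by
  have hc0 : 0 < c := by linarith
  have hΓ : (Real.Gamma c : ℂ) ≠ 0 := by exact_mod_cast (Real.Gamma_pos_of_pos hc0).ne'
  set f : ℝ → ℂ := (Ioi (0 : ℝ)).indicator
    (fun t => ((t ^ (c - 1) * Real.exp (-t) : ℝ) : ℂ)) with hf
  have hfi : Integrable f := by
    rw [hf, integrable_indicator_iff measurableSet_Ioi]
    refine IntegrableOn.congr_fun (f := fun t => ((Real.exp (-t) * t ^ (c - 1) : ℝ) : ℂ))
      (Integrable.ofReal (Real.GammaIntegral_convergent hc0)) ?_ measurableSet_Ioi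
    intro t _
    simp only [mul_comm]
  -- With `s = 1 + 2πiξ`, the Fourier transform of `t ^ (c-1) e^{-t}` is its Laplace integral at
  -- `s`. Fourier inversion at `t = 1` then gives the claim; `c > 1` makes the transform integrable.
  have hFf : (FourierTransform.fourier f : ℝ → ℂ) = fun ξ =>
      verticalLineOne ξ ^ (-c : ℂ) * (Real.Gamma c : ℂ) := by
    ext ξ
    rw [Real.fourier_real_eq_integral_exp_smul,
      ← integral_rpow_mul_cexp_neg_mul_Ioi hc0 (by rw [verticalLineOne_re]; norm_num),
      ← integral_indicator measurableSet_Ioi]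
    congr 1
    ext t
    by_cases ht : t ∈ Ioi (0 : ℝ)
    · simp only [hf, indicator_of_mem ht, smul_eq_mul, verticalLineOne]
      push_cast
      rw [mul_left_comm, ← Complex.exp_add]
      congr 2
      ring
    · simp only [hf, indicator_of_notMem ht, smul_zero]
  have hFi : Integrable (FourierTransform.fourier f : ℝ → ℂ) := by
    rw [hFf]
    refine Integrable.mul_const ?_ _
    refine (integrable_norm_verticalLineOne_rpow hc).mono'
      (continuous_verticalLineOne_cpow _).aestronglyMeasurable
      (Filter.Eventually.of_forall fun ξ => (norm_verticalLineOne_cpow c ξ).le)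
  have hcont : ContinuousAt f 1 := by
    have : ContinuousAt (fun t : ℝ => ((t ^ (c - 1) * Real.exp (-t) : ℝ) : ℂ)) 1 := by
      refine Complex.continuous_ofReal.continuousAt.comp ?_
      exact (Real.continuousAt_rpow_const _ _ (Or.inl one_ne_zero)).mul (by fun_prop)
    refine this.congr ?_
    filter_upwards [Ioi_mem_nhds (zero_lt_one (α := ℝ))] with t ht
    rw [hf, indicator_of_mem ht]
  have hinv := hfi.fourierInv_fourier_eq hFi hcont
  rw [hFf, Real.fourierInv_eq'] at hinv
  simp only [hf, indicator_of_mem (show (1 : ℝ) ∈ Ioi 0 from mem_Ioi.2 one_pos),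
    Real.one_rpow, one_mul] at hinv
  have h1 : ∫ ξ : ℝ, Complex.exp (verticalLineOne ξ) * verticalLineOne ξ ^ (-c : ℂ) =
      Complex.exp 1 * (Real.Gamma c : ℂ)⁻¹ * ∫ ξ : ℝ, Complex.exp (↑(2 * Real.pi * inner ℝ ξ 1) *
        Complex.I) • (verticalLineOne ξ ^ (-c : ℂ) * (Real.Gamma c : ℂ)) := by
    rw [← integral_const_mul]
    congr 1
    ext ξ
    have : Complex.exp (verticalLineOne ξ) = Complex.exp 1 *
        Complex.exp (↑(2 * Real.pi * inner ℝ ξ (1 : ℝ)) * Complex.I) := by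
      rw [← Complex.exp_add]
      simp [verticalLineOne]
    rw [this, smul_eq_mul]
    field_simp
  rw [h1, hinv]
  push_cast
  rw [mul_right_comm, ← Complex.exp_add]
  simp

/-- On `Re s = 1` the argument of `s ^ (-a)` is at most `aπ/2 < π` in absolute value, so `x s ^
(-a)` stays in a sector avoiding the negative axis, and the distance from `-1` to that sector is at
least `sin(aπ/2)`. -/
theorem sin_le_norm_one_add_mul_verticalLineOne_cpow {a : ℝ} (ha0 : 0 < a) (ha2 : a < 2)
    {x : ℝ} (hx : 0 ≤ x) (ξ : ℝ) :
    Real.sin (a * (Real.pi / 2)) ≤ ‖1 + x * verticalLineOne ξ ^ (-a : ℂ)‖ := by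
  set s := verticalLineOne ξ with hs
  set ρ : ℝ := x * ‖s‖ ^ (-a) with hρ
  have hρ0 : 0 ≤ ρ := by positivity
  set θ : ℝ := a * s.arg with hθ
  have harg : |s.arg| ≤ Real.pi / 2 := by
    rw [Complex.abs_arg_le_pi_div_two_iff, hs, verticalLineOne_re]; norm_num
  have hw : (x : ℂ) * s ^ (-a : ℂ) = ρ * Complex.exp (-(θ : ℂ) * Complex.I) := by
    rw [Complex.cpow_def_of_ne_zero (verticalLineOne_ne_zero ξ), Complex.log, hρ,
      Real.rpow_def_of_pos (norm_pos_iff.2 (verticalLineOne_ne_zero ξ))]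
    push_cast
    rw [mul_assoc, ← Complex.exp_add]
    congr 2
    rw [hθ]
    push_cast
    ring
  have hcos : Real.cos (a * (Real.pi / 2)) ≤ Real.cos θ := by
    rw [← Real.cos_abs θ]
    have h1 : |θ| ≤ a * (Real.pi / 2) := by
      rw [hθ, abs_mul, abs_of_pos ha0]
      gcongr
    exact Real.cos_le_cos_of_nonneg_of_le_pi (abs_nonneg _) (by nlinarith [Real.pi_pos]) h1
  have hnorm : ‖1 + x * s ^ (-a : ℂ)‖ ^ 2 = 1 + 2 * ρ * Real.cos θ + ρ ^ 2 := by
    have hexp : Complex.exp (-(θ : ℂ) * Complex.I) = (Real.cos θ : ℂ) - Real.sin θ * Complex.I := by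
      rw [Complex.exp_mul_I]
      simp [sub_eq_add_neg]
    rw [hw, hexp, ← Complex.normSq_eq_norm_sq, Complex.normSq_apply]
    simp only [Complex.add_re, Complex.one_re, Complex.mul_re, Complex.ofReal_re, Complex.sub_re,
      Complex.I_re, Complex.ofReal_im, Complex.I_im, Complex.add_im, Complex.one_im,
      Complex.mul_im, Complex.sub_im]
    nlinarith [Real.sin_sq_add_cos_sq θ]
  refine le_of_sq_le_sq ?_ (norm_nonneg _)
  rw [hnorm]
  -- With `C = cos(aπ/2)`: `1 + 2ρ cos θ + ρ² ≥ 1 + 2ρC + ρ² = (ρ + C)² + sin²(aπ/2)`.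
  nlinarith [Real.sin_sq_add_cos_sq (a * (Real.pi / 2)), sq_nonneg (ρ + Real.cos (a * (Real.pi / 2))),
    mul_le_mul_of_nonneg_left hcos hρ0]

/-! ### Convergence and shift relation of the Mittag-Leffler series. -/

/-- Keep only `t > M` in the Gamma integral. As `M` is arbitrary, `Γ` outgrows every geometric
sequence. -/
theorem rpow_mul_exp_neg_le_Gamma {M y : ℝ} (hM : 0 < M) (hy : 1 ≤ y) :
    M ^ (y - 1) * Real.exp (-M) ≤ Real.Gamma y := by
  have hy0 : 0 < y := by linarith
  rw [Real.Gamma_eq_integral hy0]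
  have hint := Real.GammaIntegral_convergent hy0
  have hexp : IntegrableOn (fun t : ℝ => Real.exp (-t)) (Ioi M) := integrableOn_exp_neg_Ioi M
  calc M ^ (y - 1) * Real.exp (-M) = ∫ t in Ioi M, Real.exp (-t) * M ^ (y - 1) := by
        rw [integral_mul_const, integral_exp_neg_Ioi, mul_comm]
    _ ≤ ∫ t in Ioi M, Real.exp (-t) * t ^ (y - 1) := by
        refine setIntegral_mono_on (hexp.mul_const _) (hint.mono_set (Ioi_subset_Ioi hM.le))
          measurableSet_Ioi fun t ht => ?_
        have : M ≤ t := le_of_lt ht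
        gcongr
    _ ≤ ∫ t in Ioi 0, Real.exp (-t) * t ^ (y - 1) := by
        refine setIntegral_mono_set hint ?_ (Filter.Eventually.of_forall (Ioi_subset_Ioi hM.le))
        filter_upwards [ae_restrict_mem measurableSet_Ioi] with t ht
        have : (0 : ℝ) < t := ht
        simp only [Pi.zero_apply]
        positivity

theorem summable_pow_div_Gamma {a b R : ℝ} (ha : 0 < a) (hb : 0 < b) (hR : 0 ≤ R) :
    Summable fun n : ℕ => R ^ n / Real.Gamma (a * n + b) := by
  -- Chosen so that `M ^ a = 2R + 1`, which leaves a geometric series of ratio `R / (2R + 1) < 1`.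
  set M : ℝ := (2 * R + 1) ^ (1 / a) with hMdef
  have hM : 0 < M := by positivity
  have hMa : M ^ a = 2 * R + 1 := by
    rw [hMdef, ← Real.rpow_mul (by positivity), one_div_mul_cancel ha.ne', Real.rpow_one]
  have hgeo : Summable fun n : ℕ => (M ^ (1 - b) * Real.exp M) * (R / (2 * R + 1)) ^ n := by
    refine (summable_geometric_of_lt_one (by positivity) ?_).mul_left _
    rw [div_lt_one (by positivity)]
    linarith
  refine hgeo.of_norm_bounded_eventually_nat ?_
  obtain ⟨N, hN⟩ := exists_nat_ge (1 / a)
  filter_upwards [Filter.eventually_ge_atTop N] with n hn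
  have hn' : 1 ≤ a * n := by
    have : 1 / a ≤ n := hN.trans (by exact_mod_cast hn)
    rwa [div_le_iff₀' ha] at this
  have hpos : 0 < Real.Gamma (a * n + b) := Real.Gamma_pos_of_pos (by positivity)
  rw [Real.norm_of_nonneg (by positivity), div_le_iff₀ hpos]
  have h := rpow_mul_exp_neg_le_Gamma hM (by linarith : 1 ≤ a * n + b)
  have hsplit : M ^ (a * n + b - 1) = (2 * R + 1) ^ n * (M ^ (1 - b))⁻¹ := by
    rw [← Real.rpow_neg hM.le, ← hMa, ← Real.rpow_natCast, ← Real.rpow_mul hM.le,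
      ← Real.rpow_add hM]
    congr 1
    ring
  rw [hsplit] at h
  calc R ^ n = (M ^ (1 - b) * Real.exp M) * (R / (2 * R + 1)) ^ n *
        ((2 * R + 1) ^ n * (M ^ (1 - b))⁻¹ * Real.exp (-M)) := by
        rw [div_pow, Real.exp_neg]
        have : (2 * R + 1) ^ n ≠ 0 := by positivity
        field_simp
    _ ≤ _ := by gcongr

theorem summable_mittagLeffler {a b : ℝ} (ha : 0 < a) (hb : 0 < b) (z : ℝ) :
    Summable fun n : ℕ => z ^ n / Real.Gamma (a * n + b) := by
  refine Summable.of_norm ((summable_pow_div_Gamma ha hb (abs_nonneg z)).congr fun n => ?_)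
  rw [norm_div, norm_pow, Real.norm_eq_abs, Real.norm_of_nonneg
    (Real.Gamma_pos_of_pos (by positivity)).le]

theorem mittagLeffler_eq_inv_Gamma_add {a b : ℝ} (ha : 0 < a) (hb : 0 < b) (z : ℝ) :
    mittagLeffler a b z = (Real.Gamma b)⁻¹ + z * mittagLeffler a (a + b) z := by
  unfold mittagLeffler
  rw [(summable_mittagLeffler ha hb z).tsum_eq_zero_add, ← tsum_mul_left]
  congr 1
  · simp
  · congr 1
    ext n
    rw [pow_succ']
    push_cast
    rw [mul_div_assoc]
    congr 3
    ring

theorem differentiable_tsum_pow_div_Gamma {a b : ℝ} (ha : 0 < a) (hb : 0 < b) :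
    Differentiable ℂ fun z : ℂ => ∑' n : ℕ, z ^ n / (Real.Gamma (a * n + b) : ℂ) := by
  intro z
  have h := Complex.differentiableOn_tsum_of_summable_norm (U := Metric.ball 0 (‖z‖ + 1))
    (F := fun (n : ℕ) (z : ℂ) => z ^ n / (Real.Gamma (a * n + b) : ℂ))
    (summable_pow_div_Gamma ha hb (R := ‖z‖ + 1) (by positivity)) (fun n => by fun_prop)
    Metric.isOpen_ball ?_
  · exact h.differentiableAt (Metric.isOpen_ball.mem_nhds (by simp))
  · intro n w hw
    rw [mem_ball_zero_iff] at hw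
    have hpos : 0 < Real.Gamma (a * n + b) := Real.Gamma_pos_of_pos (by positivity)
    rw [norm_div, norm_pow, Complex.norm_real, Real.norm_of_nonneg hpos.le]
    gcongr

/-! ### Bromwich representation and asymptotics of the Mittag-Leffler function. -/

/-- The integrand, on the line `Re s = 1`, of the Bromwich integral of the Mittag-Leffler function
after one integration by parts. -/
noncomputable def bromwichKernel (a b : ℝ) (z : ℂ) (ξ : ℝ) : ℂ :=
  Complex.exp (verticalLineOne ξ) * verticalLineOne ξ ^ (-(b + 1 : ℝ) : ℂ) *
    ((b - a) / (1 - z * verticalLineOne ξ ^ (-a : ℂ)) +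
      a / (1 - z * verticalLineOne ξ ^ (-a : ℂ)) ^ 2)

/-- Writing `1/Γ(an+b) = (an+b)/Γ(an+b+1)` raises the exponent above 1, as absolute convergence
requires. The factor `an+b` yields `∑ (an+b) q^n = (b-a)/(1-q) + a/(1-q)²` with `q = z s^{-a}`. -/
theorem hasSum_bromwichKernel {a : ℝ} (b : ℝ) (ha : 0 < a) {z : ℂ} (hz : ‖z‖ < 1) (ξ : ℝ) :
    HasSum (fun n : ℕ => (a * n + b) * z ^ n * (Complex.exp (verticalLineOne ξ) *
      verticalLineOne ξ ^ (-(a * n + b + 1 : ℝ) : ℂ))) (bromwichKernel a b z ξ) := by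
  set s := verticalLineOne ξ with hs
  set q := z * s ^ (-a : ℂ) with hq
  have hq1 : ‖q‖ < 1 := by
    rw [hq, norm_mul]
    have := norm_verticalLineOne_cpow_le_one ha.le ξ
    nlinarith [norm_nonneg z]
  have hq' : 1 - q ≠ 0 := by
    intro h
    rw [← sub_eq_zero.1 h] at hq1
    simp at hq1
  have h1 := (hasSum_coe_mul_geometric_of_norm_lt_one hq1).mul_left (a : ℂ)
  have h2 := (hasSum_geometric_of_norm_lt_one hq1).mul_left (b : ℂ)
  have h3 := (h1.add h2).mul_left (Complex.exp s * s ^ (-(b + 1 : ℝ) : ℂ))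
  convert! h3 using 1
  · ext n
    have : s ^ (-(a * n + b + 1 : ℝ) : ℂ) = s ^ (-(b + 1 : ℝ) : ℂ) * (s ^ (-a : ℂ)) ^ n := by
      rw [← Complex.cpow_nat_mul, ← Complex.cpow_add _ _ (verticalLineOne_ne_zero ξ)]
      congr 1
      push_cast
      ring
    rw [this, hq, mul_pow]
    ring
  · rw [bromwichKernel, ← hs, ← hq]
    congr 1
    field_simp
    ring

theorem tsum_pow_div_Gamma_eq_integral_of_norm_lt_one {a b : ℝ} (ha : 0 < a) (hb : 0 < b) {z : ℂ}
    (hz : ‖z‖ < 1) :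
    ∑' n : ℕ, z ^ n / (Real.Gamma (a * n + b) : ℂ) = ∫ ξ, bromwichKernel a b z ξ := by
  have hnorm : ∀ (n : ℕ) (ξ : ℝ), ‖(a * n + b) * z ^ n * (Complex.exp (verticalLineOne ξ) *
      verticalLineOne ξ ^ (-(a * n + b + 1 : ℝ) : ℂ))‖ ≤
      (a * n + b) * ‖z‖ ^ n * Real.exp 1 * ‖verticalLineOne ξ‖ ^ (-(b + 1)) := by
    intro n ξ
    have h1 : ‖(a * n + b : ℂ)‖ = a * n + b := by
      have : (a * n + b : ℂ) = ((a * n + b : ℝ) : ℂ) := by push_cast; rfl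
      rw [this, Complex.norm_real, Real.norm_of_nonneg (by positivity)]
    rw [norm_mul, norm_mul, norm_mul, norm_pow, norm_cexp_verticalLineOne,
      norm_verticalLineOne_cpow, h1, mul_assoc _ (Real.exp 1)]
    have : ‖verticalLineOne ξ‖ ^ (-(a * n + b + 1)) ≤ ‖verticalLineOne ξ‖ ^ (-(b + 1)) := by
      apply Real.rpow_le_rpow_of_exponent_le (one_le_norm_verticalLineOne ξ)
      have : 0 ≤ a * n := by positivity
      linarith
    gcongr
  have hbase := integrable_norm_verticalLineOne_rpow (c := b + 1) (by linarith)
  have hint : ∀ n : ℕ, Integrable fun ξ : ℝ => (a * n + b) * z ^ n *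
      (Complex.exp (verticalLineOne ξ) * verticalLineOne ξ ^ (-(a * n + b + 1 : ℝ) : ℂ)) := by
    intro n
    refine (hbase.const_mul ((a * n + b) * ‖z‖ ^ n * Real.exp 1)).mono' ?_
      (Filter.Eventually.of_forall (hnorm n))
    exact (continuous_const.mul ((Complex.continuous_exp.comp continuous_verticalLineOne).mul
      (continuous_verticalLineOne_cpow _))).aestronglyMeasurable
  have hsum : Summable fun n : ℕ => ∫ ξ : ℝ, ‖(a * n + b) * z ^ n *
      (Complex.exp (verticalLineOne ξ) * verticalLineOne ξ ^ (-(a * n + b + 1 : ℝ) : ℂ))‖ := by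
    have hz' : ‖‖z‖‖ < 1 := by simpa
    have h1 := ((hasSum_coe_mul_geometric_of_norm_lt_one hz').summable.mul_left a).add
      ((summable_geometric_of_norm_lt_one hz').mul_left b)
    refine Summable.of_nonneg_of_le (fun n => integral_nonneg fun ξ => norm_nonneg _)
      (fun n => ?_) (h1.mul_right (Real.exp 1 * ∫ ξ, ‖verticalLineOne ξ‖ ^ (-(b + 1))))
    refine (integral_mono (hint n).norm (hbase.const_mul _) (hnorm n)).trans (le_of_eq ?_)
    rw [integral_const_mul]
    ring
  have h := hasSum_integral_of_summable_integral_norm hint hsum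
  have h2 : ∀ ξ : ℝ, ∑' n : ℕ, (a * n + b) * z ^ n * (Complex.exp (verticalLineOne ξ) *
      verticalLineOne ξ ^ (-(a * n + b + 1 : ℝ) : ℂ)) = bromwichKernel a b z ξ :=
    fun ξ => (hasSum_bromwichKernel b ha hz ξ).tsum_eq
  simp only [h2] at h
  rw [← h.tsum_eq]
  congr 1
  ext n
  have hpos : 0 < a * n + b := by positivity
  rw [integral_const_mul, integral_cexp_mul_verticalLineOne_cpow (by linarith),
    Real.Gamma_add_one hpos.ne']
  have h3 : Real.Gamma (a * n + b) ≠ 0 := (Real.Gamma_pos_of_pos hpos).ne'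
  have h4 : (a * n + b : ℂ) ≠ 0 := by exact_mod_cast hpos.ne'
  have h5 : (Real.Gamma (a * n + b) : ℂ) ≠ 0 := by exact_mod_cast h3
  push_cast
  field_simp

theorem continuous_bromwichKernel (a b : ℝ) {z : ℂ}
    (hz : ∀ ξ, 1 - z * verticalLineOne ξ ^ (-a : ℂ) ≠ 0) : Continuous (bromwichKernel a b z) := by
  have h := continuous_verticalLineOne_cpow (-a)
  have h' := continuous_verticalLineOne_cpow (-(b + 1 : ℝ) : ℂ)
  have hD : Continuous fun ξ => 1 - z * verticalLineOne ξ ^ (-a : ℂ) := by fun_prop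
  unfold bromwichKernel
  refine ((Complex.continuous_exp.comp continuous_verticalLineOne).mul h').mul ?_
  exact (continuous_const.div hD hz).add (continuous_const.div (hD.pow 2) fun ξ =>
    pow_ne_zero 2 (hz ξ))

theorem norm_bromwichKernel_le {a b : ℝ} {z : ℂ} {κ : ℝ} (hκ : 0 < κ) {ξ : ℝ}
    (hz : κ ≤ ‖1 - z * verticalLineOne ξ ^ (-a : ℂ)‖) :
    ‖bromwichKernel a b z ξ‖ ≤
      Real.exp 1 * (|b - a| / κ + |a| / κ ^ 2) * ‖verticalLineOne ξ‖ ^ (-(b + 1)) := by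
  have h1 : ‖(b - a : ℂ)‖ = |b - a| := by
    rw [← Complex.ofReal_sub, Complex.norm_real, Real.norm_eq_abs]
  rw [bromwichKernel, norm_mul, norm_mul, norm_cexp_verticalLineOne, norm_verticalLineOne_cpow,
    mul_right_comm]
  gcongr
  refine (norm_add_le _ _).trans ?_
  rw [norm_div, norm_div, norm_pow, h1, Complex.norm_real, Real.norm_eq_abs]
  gcongr

/-- The Bromwich representation on the negative half-line. -/
theorem mittagLeffler_neg_eq_integral {a b : ℝ} (ha0 : 0 < a) (ha2 : a < 2) (hb : 0 < b) {x : ℝ}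
    (hx : 0 ≤ x) :
    (mittagLeffler a b (-x) : ℂ) = ∫ ξ, bromwichKernel a b (-x) ξ := by
  set κ := Real.sin (a * (Real.pi / 2)) with hκdef
  have hκ : 0 < κ := Real.sin_pos_of_pos_of_lt_pi (by positivity) (by nlinarith [Real.pi_pos])
  set S : Set ℂ := (fun x : ℝ => (-x : ℂ)) '' Ici 0 with hS
  -- Since `|s ^ (-a)| ≤ 1`, moving `z` by less than `κ / 2` off the negative axis costs at most
  -- half of the lower bound `κ` on the denominator.
  set U := Metric.thickening (κ / 2) S with hU
  have hUo : IsOpen U := Metric.isOpen_thickening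
  have hUc : IsPreconnected U := by
    refine (Convex.thickening ?_ _).isPreconnected
    have := (convex_Ici (0 : ℝ)).linear_image (-Complex.ofRealCLM.toLinearMap)
    simpa [hS] using this
  have hSU : S ⊆ U := Metric.self_subset_thickening (by positivity) S
  have hD : ∀ z ∈ U, ∀ ξ, κ / 2 ≤ ‖1 - z * verticalLineOne ξ ^ (-a : ℂ)‖ := by
    intro z hz ξ
    obtain ⟨_, ⟨y, hy, rfl⟩, hyz⟩ := Metric.mem_thickening_iff.1 hz
    rw [dist_eq_norm] at hyz
    have h1 := sin_le_norm_one_add_mul_verticalLineOne_cpow ha0 ha2 (x := y) hy ξ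
    have h2 := norm_verticalLineOne_cpow_le_one ha0.le ξ
    have h3 : 1 + (y : ℂ) * verticalLineOne ξ ^ (-a : ℂ) =
        (1 - z * verticalLineOne ξ ^ (-a : ℂ)) +
          (z - (-y : ℂ)) * verticalLineOne ξ ^ (-a : ℂ) := by ring
    have h4 : ‖(z - (-y : ℂ)) * verticalLineOne ξ ^ (-a : ℂ)‖ ≤ κ / 2 := by
      rw [norm_mul]
      nlinarith [norm_nonneg (z - (-y : ℂ))]
    rw [h3] at h1
    linarith [norm_add_le (1 - z * verticalLineOne ξ ^ (-a : ℂ))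
      ((z - (-y : ℂ)) * verticalLineOne ξ ^ (-a : ℂ))]
  have hD' : ∀ z ∈ U, ∀ ξ, 1 - z * verticalLineOne ξ ^ (-a : ℂ) ≠ 0 := fun z hz ξ =>
    norm_pos_iff.1 (lt_of_lt_of_le (by positivity) (hD z hz ξ))
  have hR : DifferentiableOn ℂ (fun z => ∫ ξ, bromwichKernel a b z ξ) U := by
    refine differentiableOn_integral_of_dominated hUo
      ((integrable_norm_verticalLineOne_rpow (c := b + 1) (by linarith)).const_mul
        (Real.exp 1 * (|b - a| / (κ / 2) + |a| / (κ / 2) ^ 2)))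
      (fun z hz => (continuous_bromwichKernel a b (hD' z hz)).aestronglyMeasurable) ?_
      (fun z hz ξ => norm_bromwichKernel_le (by positivity) (hD z hz ξ))
    intro ξ z hz
    have := hD' z hz ξ
    unfold bromwichKernel
    refine DifferentiableAt.differentiableWithinAt ?_
    fun_prop (disch := first | assumption | exact pow_ne_zero 2 this)
  have h0 : (0 : ℂ) ∈ U := hSU ⟨0, by simp, by simp⟩
  -- The identity theorem extends the equality from the unit disc to all of the connected set `U`.
  have key := ((differentiable_tsum_pow_div_Gamma ha0 hb).differentiableOn.analyticOnNhd
    hUo).eqOn_of_preconnected_of_eventuallyEq (hR.analyticOnNhd hUo) hUc h0 (by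
      filter_upwards [Metric.ball_mem_nhds (0 : ℂ) one_pos] with z hz
      exact tsum_pow_div_Gamma_eq_integral_of_norm_lt_one ha0 hb (by simpa using hz))
  have hxU := key (hSU ⟨x, hx, rfl⟩)
  simp only at hxU
  rw [← hxU, mittagLeffler]
  push_cast
  rfl

-- The sector estimate dominates the kernel uniformly in `x ≥ 0`, and for fixed `ξ` the denominator
-- `1 + x s^{-a}` tends to infinity.
open Filter Topology in
theorem tendsto_mittagLeffler_neg_atTop {a b : ℝ} (ha0 : 0 < a) (ha2 : a < 2) (hb : 0 < b) :
    Tendsto (fun x : ℝ => mittagLeffler a b (-x)) atTop (𝓝 0) := by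
  set κ := Real.sin (a * (Real.pi / 2)) with hκdef
  have hκ : 0 < κ := Real.sin_pos_of_pos_of_lt_pi (by positivity) (by nlinarith [Real.pi_pos])
  have hD : ∀ x : ℝ, 0 ≤ x → ∀ ξ, κ ≤ ‖1 - (-x : ℂ) * verticalLineOne ξ ^ (-a : ℂ)‖ := by
    intro x hx ξ
    simpa using sin_le_norm_one_add_mul_verticalLineOne_cpow ha0 ha2 hx ξ
  have hlim : Tendsto (fun x : ℝ => ∫ ξ, bromwichKernel a b (-x) ξ) atTop
      (𝓝 (∫ _ : ℝ, (0 : ℂ))) := by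
    refine tendsto_integral_filter_of_dominated_convergence
      (fun ξ => Real.exp 1 * (|b - a| / κ + |a| / κ ^ 2) * ‖verticalLineOne ξ‖ ^ (-(b + 1)))
      ?_ ?_ ((integrable_norm_verticalLineOne_rpow (c := b + 1) (by linarith)).const_mul _) ?_
    · filter_upwards [eventually_ge_atTop 0] with x hx
      exact (continuous_bromwichKernel a b fun ξ =>
        norm_pos_iff.1 (hκ.trans_le (hD x hx ξ))).aestronglyMeasurable
    · filter_upwards [eventually_ge_atTop 0] with x hx
      exact Eventually.of_forall fun ξ => norm_bromwichKernel_le hκ (hD x hx ξ)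
    · refine Eventually.of_forall fun ξ => ?_
      have hw : 0 < ‖verticalLineOne ξ ^ (-a : ℂ)‖ := by
        rw [norm_verticalLineOne_cpow]
        exact Real.rpow_pos_of_pos (norm_pos_iff.2 (verticalLineOne_ne_zero ξ)) _
      have hcob : Tendsto (fun x : ℝ => 1 - (-x : ℂ) * verticalLineOne ξ ^ (-a : ℂ)) atTop
          (Bornology.cobounded ℂ) := by
        rw [← tendsto_norm_atTop_iff_cobounded]
        refine tendsto_atTop_mono' _ (f₁ := fun x : ℝ => x * ‖verticalLineOne ξ ^ (-a : ℂ)‖ - 1)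
          ?_ (tendsto_atTop_add_const_right _ _ (tendsto_id.atTop_mul_const hw))
        filter_upwards [eventually_ge_atTop 0] with x hx
        have h1 : (x : ℂ) * verticalLineOne ξ ^ (-a : ℂ) =
          (1 - (-x : ℂ) * verticalLineOne ξ ^ (-a : ℂ)) - 1 := by ring
        have h2 := norm_sub_le (1 - (-x : ℂ) * verticalLineOne ξ ^ (-a : ℂ)) 1
        rw [← h1, norm_mul, Complex.norm_real, Real.norm_of_nonneg hx, norm_one] at h2
        linarith
      have hinv := tendsto_inv₀_cobounded.comp hcob
      have h3 := (hinv.const_mul (b - a : ℂ)).add ((hinv.pow 2).const_mul (a : ℂ))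
      have h4 := h3.const_mul
        (Complex.exp (verticalLineOne ξ) * verticalLineOne ξ ^ (-(b + 1 : ℝ) : ℂ))
      simpa [bromwichKernel, div_eq_mul_inv, Function.comp_def] using h4
  rw [integral_zero] at hlim
  have h := (Complex.continuous_re.tendsto 0).comp hlim
  refine h.congr' ?_
  filter_upwards [eventually_ge_atTop 0] with x hx
  rw [Function.comp_apply, ← mittagLeffler_neg_eq_integral ha0 ha2 hb hx, Complex.ofReal_re]

open Filter Topology in
/-- The leading term of `E_{a,b}(-x)` as `x → ∞`. -/
theorem tendsto_mul_mittagLeffler_neg_atTop {a b : ℝ} (ha0 : 0 < a) (ha2 : a < 2) (hab : a < b) :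
    Tendsto (fun x : ℝ => x * mittagLeffler a b (-x)) atTop (𝓝 (Real.Gamma (b - a))⁻¹) := by
  -- The decay is applied to the parameter `b - a`, then carried to `b` by the shift relation.
  have h := (tendsto_mittagLeffler_neg_atTop ha0 ha2 (sub_pos.2 hab)).const_sub
    (Real.Gamma (b - a))⁻¹
  rw [sub_zero] at h
  refine h.congr fun x => ?_
  rw [mittagLeffler_eq_inv_Gamma_add ha0 (sub_pos.2 hab), add_sub_cancel]
  ring

/-! ### Weak derivatives on the unit interval. -/

theorem exists_tsupport_subset_Icc {φ : ℝ → ℝ} (hφ : HasCompactSupport φ)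
    (hs : tsupport φ ⊆ Ioo 0 1) :
    ∃ a b : ℝ, 0 < a ∧ a ≤ b ∧ b < 1 ∧ tsupport φ ⊆ Icc a b := by
  rcases (tsupport φ).eq_empty_or_nonempty with h | h
  · exact ⟨1 / 2, 1 / 2, by norm_num, le_rfl, by norm_num, by simp [h]⟩
  · have hc : IsCompact (tsupport φ) := hφ
    have ha := hs (hc.sInf_mem h)
    have hb := hs (hc.sSup_mem h)
    refine ⟨sInf (tsupport φ), sSup (tsupport φ), ha.1, ?_, hb.2, fun x hx =>
      ⟨csInf_le hc.bddBelow hx, le_csSup hc.bddAbove hx⟩⟩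
    exact csInf_le hc.bddBelow (hc.sSup_mem h)

/-- A test function on `(0, 1)` with zero mean is the derivative of a test function. -/
theorem exists_deriv_eq_of_integral_eq_zero {u : ℝ → ℝ} (hu : ContDiff ℝ ∞ u)
    (hc : HasCompactSupport u) (hs : tsupport u ⊆ Ioo 0 1) (h0 : ∫ x, u x = 0) :
    ∃ φ : ℝ → ℝ, ContDiff ℝ ∞ φ ∧ HasCompactSupport φ ∧ tsupport φ ⊆ Ioo 0 1 ∧ deriv φ = u := by
  obtain ⟨a, b, ha, hab, hb, hsub⟩ := exists_tsupport_subset_Icc hc hs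
  have hd : ∀ x, HasDerivAt (fun x => ∫ t in (0 : ℝ)..x, u t) (u x) x := fun x =>
    intervalIntegral.integral_hasDerivAt_right (hu.continuous.intervalIntegrable _ _)
      hu.continuous.stronglyMeasurable.stronglyMeasurableAtFilter hu.continuous.continuousAt
  have hderiv : deriv (fun x => ∫ t in (0 : ℝ)..x, u t) = u := funext fun x => (hd x).deriv
  have hu0 : ∀ t, t ∉ Icc a b → u t = 0 := fun t ht =>
    image_eq_zero_of_notMem_tsupport fun h => ht (hsub h)
  have hsupp : tsupport (fun x => ∫ t in (0 : ℝ)..x, u t) ⊆ Icc a b := by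
    refine closure_minimal (fun x hx => ?_) isClosed_Icc
    by_contra hx'
    refine hx ?_
    change ∫ t in (0 : ℝ)..x, u t = 0
    rcases lt_or_ge x a with hxa | hxa
    · rw [intervalIntegral.integral_congr (g := fun _ => (0 : ℝ)), intervalIntegral.integral_zero]
      intro t ht
      refine hu0 t fun h => ?_
      rcases le_total 0 x with h1 | h1
      · rw [uIcc_of_le h1] at ht
        linarith [ht.2, h.1]
      · rw [uIcc_of_ge h1] at ht
        linarith [ht.2, h.1]
    · have hxb : b < x := by
        by_contra h
        exact hx' ⟨hxa, not_lt.1 h⟩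
      -- To the right of the support the primitive equals the total integral, which is zero.
      rw [intervalIntegral.integral_eq_integral_of_support_subset, h0]
      intro t ht
      have : t ∈ Icc a b := by
        by_contra h
        exact ht (hu0 t h)
      exact ⟨by linarith [this.1], by linarith [this.2]⟩
  refine ⟨_, ?_, HasCompactSupport.of_support_subset_isCompact isCompact_Icc
    ((subset_tsupport _).trans hsupp), hsupp.trans fun x hx => ⟨by linarith [hx.1], by
      linarith [hx.2]⟩, hderiv⟩
  rw [contDiff_infty_iff_deriv, hderiv]
  exact ⟨fun x => (hd x).differentiableAt, hu⟩

/-- The lemma of du Bois-Reymond. -/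
theorem exists_ae_eq_const_of_integral_mul_deriv_eq_zero {G : ℝ → ℝ}
    (hG : IntegrableOn G (Ioo 0 1))
    (h : ∀ φ : ℝ → ℝ, ContDiff ℝ ∞ φ → HasCompactSupport φ → tsupport φ ⊆ Ioo 0 1 →
      ∫ x in Ioo (0 : ℝ) 1, G x * deriv φ x = 0) :
    ∃ C : ℝ, ∀ᵐ x, x ∈ Ioo (0 : ℝ) 1 → G x = C := by
  let B : ContDiffBump (1 / 2 : ℝ) := ⟨1 / 8, 1 / 4, by norm_num, by norm_num⟩
  set η : ℝ → ℝ := B.normed volume with hη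
  have hηc : ContDiff ℝ ∞ η := B.contDiff_normed
  have hηs : HasCompactSupport η := B.hasCompactSupport_normed
  have hηt : tsupport η ⊆ Ioo 0 1 := by
    rw [hη, B.tsupport_normed_eq, Real.closedBall_eq_Icc]
    intro x hx
    have h1 : 1 / 2 - 1 / 4 ≤ x := hx.1
    have h2 : x ≤ 1 / 2 + 1 / 4 := hx.2
    constructor <;> linarith
  have hη1 : ∫ x, η x = 1 := B.integral_normed
  have hmul : ∀ φ : ℝ → ℝ, Continuous φ → IntegrableOn (fun x => G x * φ x) (Ioo 0 1) :=
    fun φ hφ => hG.mul_continuousOn_of_subset hφ.continuousOn measurableSet_Ioo isCompact_Icc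
      Ioo_subset_Icc_self
  set C : ℝ := ∫ x in Ioo (0 : ℝ) 1, G x * η x with hC
  refine ⟨C, ?_⟩
  have hloc : LocallyIntegrableOn (fun x => G x - C) (Ioo 0 1) :=
    (hG.sub (integrableOn_const (by simp))).locallyIntegrableOn
  have key := isOpen_Ioo.ae_eq_zero_of_integral_contDiff_smul_eq_zero hloc ?_
  · filter_upwards [key] with x hx hx'
    exact sub_eq_zero.1 (hx hx')
  intro ψ hψ hψs hψt
  set m : ℝ := ∫ x, ψ x with hm
  have hψ0 : ∀ x, x ∉ Ioo (0 : ℝ) 1 → ψ x = 0 := fun x hx =>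
    image_eq_zero_of_notMem_tsupport fun h => hx (hψt h)
  -- Subtracting `m η`, where `η` has integral 1, makes `ψ` mean-free and hence a derivative of a
  -- test function.
  have hu : ContDiff ℝ ∞ fun x => ψ x - m * η x := hψ.sub (contDiff_const.mul hηc)
  have hus : HasCompactSupport fun x => ψ x - m * η x := hψs.sub hηs.mul_left
  have hut : tsupport (fun x => ψ x - m * η x) ⊆ Ioo 0 1 := by
    refine (tsupport_sub ψ (fun x => m * η x)).trans (union_subset hψt ?_)
    exact (tsupport_mul_subset_right (f := fun _ => m) (g := η)).trans hηt
  have hψi : Integrable ψ := hψ.continuous.integrable_of_hasCompactSupport hψs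
  have hηi : Integrable η := hηc.continuous.integrable_of_hasCompactSupport hηs
  have hu0 : ∫ x, (ψ x - m * η x) = 0 := by
    rw [integral_sub hψi (hηi.const_mul m), integral_const_mul, hη1]
    simp [hm]
  obtain ⟨φ, hφ, hφs, hφt, hφd⟩ := exists_deriv_eq_of_integral_eq_zero hu hus hut hu0
  have h1 := h φ hφ hφs hφt
  rw [hφd] at h1
  have h2 : ∫ x in Ioo (0 : ℝ) 1, G x * ψ x = m * C := by
    have h3 : (fun x => G x * (ψ x - m * η x)) = fun x => G x * ψ x - m * (G x * η x) := by
      ext x; ring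
    rw [h3, integral_sub (hmul ψ hψ.continuous) ((hmul η hηc.continuous).const_mul m),
      integral_const_mul] at h1
    linarith
  rw [← setIntegral_eq_integral_of_forall_compl_eq_zero (s := Ioo (0 : ℝ) 1) (fun x hx => by
    simp [hψ0 x hx])]
  have h4 : (fun x => ψ x • (G x - C)) = fun x => G x * ψ x - C * ψ x := by
    ext x; rw [smul_eq_mul]; ring
  rw [h4, integral_sub (hmul ψ hψ.continuous) (hψi.integrableOn.const_mul C), h2,
    integral_const_mul, setIntegral_eq_integral_of_forall_compl_eq_zero hψ0]
  ring

/-- Integration by parts for absolutely continuous functions shows that the primitive of `f'` has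
weak derivative `f'`; the difference from `f` is constant by du Bois-Reymond. -/
theorem HasWeakDerivUnit.ae_eq_const_add_integral {f f' : ℝ → ℝ} (hf : IntegrableOn f (Ioo 0 1))
    (hf' : IntegrableOn f' (Ioo 0 1)) (h : HasWeakDerivUnit f f') :
    ∃ C : ℝ, ∀ᵐ x, x ∈ Ioo (0 : ℝ) 1 → f x = C + ∫ t in (0 : ℝ)..x, f' t := by
  have hI : IntervalIntegrable f' volume 0 1 := by
    rwa [intervalIntegrable_iff_integrableOn_Ioo_of_le zero_le_one]
  have hac : AbsolutelyContinuousOnInterval (fun x => ∫ t in (0 : ℝ)..x, f' t) 0 1 :=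
    hI.absolutelyContinuousOnInterval_intervalIntegral (by simp)
  have hcont : ContinuousOn (fun x => ∫ t in (0 : ℝ)..x, f' t) (Icc 0 1) := by
    simpa using hac.continuousOn
  have hFi : IntegrableOn (fun x => ∫ t in (0 : ℝ)..x, f' t) (Ioo 0 1) :=
    hcont.integrableOn_Icc.mono_set Ioo_subset_Icc_self
  have key := exists_ae_eq_const_of_integral_mul_deriv_eq_zero (hf.sub hFi) ?_
  · obtain ⟨C, hC⟩ := key
    refine ⟨C, hC.mono fun x hx hx' => ?_⟩
    have := hx hx'
    simp only [Pi.sub_apply] at this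
    linarith
  intro φ hφ hφs hφt
  have hφ0 : ∀ x, x ∉ Ioo (0 : ℝ) 1 → φ x = 0 := fun x hx =>
    image_eq_zero_of_notMem_tsupport fun h => hx (hφt h)
  have hφ' : Continuous (deriv φ) := hφ.continuous_deriv (by simp)
  have hφac : AbsolutelyContinuousOnInterval φ 0 1 :=
    (hφ.of_le (by simp)).contDiffOn.absolutelyContinuousOnInterval
  have hparts := hac.integral_mul_deriv_eq_deriv_mul hφac
  rw [hφ0 1 (by simp), hφ0 0 (by simp), mul_zero, mul_zero, sub_zero, zero_sub] at hparts
  have hd : ∫ x in (0 : ℝ)..1, deriv (fun x => ∫ t in (0 : ℝ)..x, f' t) x * φ x =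
      ∫ x in (0 : ℝ)..1, f' x * φ x := by
    refine intervalIntegral.integral_congr_ae ?_
    filter_upwards [hI.ae_hasDerivAt_integral] with x hx hx'
    rw [(hx (uIoc_subset_uIcc hx') 0 (by simp)).deriv]
  rw [hd, intervalIntegral.integral_of_le zero_le_one, intervalIntegral.integral_of_le zero_le_one,
    integral_Ioc_eq_integral_Ioo, integral_Ioc_eq_integral_Ioo] at hparts
  have hw := h φ hφ hφs hφt
  have hsplit : (fun x => (f - fun x => ∫ t in (0 : ℝ)..x, f' t) x * deriv φ x) =
      fun x => f x * deriv φ x - (∫ t in (0 : ℝ)..x, f' t) * deriv φ x := by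
    ext x
    simp only [Pi.sub_apply]
    ring
  rw [hsplit, integral_sub, hw, hparts, sub_self]
  · exact hf.mul_continuousOn_of_subset hφ'.continuousOn measurableSet_Ioo isCompact_Icc
      Ioo_subset_Icc_self
  · exact hFi.mul_continuousOn_of_subset hφ'.continuousOn measurableSet_Ioo isCompact_Icc
      Ioo_subset_Icc_self

/-! ### Eigenfunctions as absolutely continuous solutions. -/

/-- `v` is a strong solution of `v'' - g v = -lam v` on `[0, 1]` with `v 0 = v 1 = 0`, and `w` is
its derivative. -/
structure IsDirichletMode (g : ℝ → ℝ) (lam : ℝ) (v w : ℝ → ℝ) : Prop where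
  ac_fun : AbsolutelyContinuousOnInterval v 0 1
  ac_deriv : AbsolutelyContinuousOnInterval w 0 1
  zero_left : v 0 = 0
  zero_right : v 1 = 0
  deriv_fun : ∀ᵐ x, x ∈ uIoc (0 : ℝ) 1 → deriv v x = w x
  deriv_deriv : ∀ᵐ x, x ∈ uIoc (0 : ℝ) 1 → deriv w x = g x * v x - lam * v x

namespace IsDirichletMode

variable {g v w y z : ℝ → ℝ} {lam mu : ℝ}

theorem continuousOn_fun (h : IsDirichletMode g lam v w) : ContinuousOn v (Icc 0 1) := by
  simpa using h.ac_fun.continuousOn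

theorem continuousOn_deriv (h : IsDirichletMode g lam v w) : ContinuousOn w (Icc 0 1) := by
  simpa using h.ac_deriv.continuousOn

theorem const_mul (h : IsDirichletMode g lam v w) (c : ℝ) :
    IsDirichletMode g lam (fun x => c * v x) (fun x => c * w x) where
  ac_fun := h.ac_fun.const_mul c
  ac_deriv := h.ac_deriv.const_mul c
  zero_left := by simp [h.zero_left]
  zero_right := by simp [h.zero_right]
  deriv_fun := by
    filter_upwards [h.deriv_fun] with x hx hx'
    rw [deriv_const_mul_field, hx hx']
  deriv_deriv := by
    filter_upwards [h.deriv_deriv] with x hx hx'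
    rw [deriv_const_mul_field, hx hx']
    ring

theorem apply_eq_integral (h : IsDirichletMode g lam v w) {x : ℝ} (hx : x ∈ Icc (0 : ℝ) 1) :
    v x = ∫ t in (0 : ℝ)..x, w t := by
  have hsub : uIcc 0 x ⊆ uIcc (0 : ℝ) 1 := by
    rw [uIcc_of_le hx.1, uIcc_of_le zero_le_one]
    exact Icc_subset_Icc_right hx.2
  have h1 := (h.ac_fun.mono hsub).integral_deriv_eq_sub
  rw [h.zero_left, sub_zero] at h1
  rw [← h1]
  refine intervalIntegral.integral_congr_ae ?_
  filter_upwards [h.deriv_fun] with t ht ht'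
  refine ht ?_
  rw [uIoc_of_le hx.1] at ht'
  rw [uIoc_of_le zero_le_one]
  exact Ioc_subset_Ioc_right hx.2 ht'

/-- The weak form of the equation for `y` tested with `v`; the boundary terms vanish because `v`
does at both ends. -/
theorem integral_deriv_mul_deriv (hg : IntegrableOn g (Ioo 0 1)) (h : IsDirichletMode g lam v w)
    (h' : IsDirichletMode g mu y z) :
    ∫ x in (0 : ℝ)..1, w x * z x =
      mu * (∫ x in (0 : ℝ)..1, v x * y x) - ∫ x in (0 : ℝ)..1, g x * (v x * y x) := by
  have hvy : ContinuousOn (fun x => v x * y x) (uIcc 0 1) := by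
    rw [uIcc_of_le zero_le_one]
    exact h.continuousOn_fun.mul h'.continuousOn_fun
  have hgI : IntervalIntegrable g volume 0 1 := by
    rwa [intervalIntegrable_iff_integrableOn_Ioo_of_le zero_le_one]
  have hparts := h.ac_fun.integral_mul_deriv_eq_deriv_mul h'.ac_deriv
  rw [h.zero_left, h.zero_right, zero_mul, zero_mul, sub_zero, zero_sub] at hparts
  have h1 : ∫ x in (0 : ℝ)..1, w x * z x = ∫ x in (0 : ℝ)..1, deriv v x * z x := by
    refine intervalIntegral.integral_congr_ae ?_
    filter_upwards [h.deriv_fun] with x hx hx'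
    rw [hx hx']
  have h2 : ∫ x in (0 : ℝ)..1, v x * deriv z x =
      ∫ x in (0 : ℝ)..1, (g x * (v x * y x) - mu * (v x * y x)) := by
    refine intervalIntegral.integral_congr_ae ?_
    filter_upwards [h'.deriv_deriv] with x hx hx'
    rw [hx hx']
    ring
  rw [intervalIntegral.integral_sub (hgI.mul_continuousOn hvy)
    (hvy.intervalIntegrable.const_mul mu), intervalIntegral.integral_const_mul] at h2
  linarith

theorem integral_mul_eq_zero (hg : IntegrableOn g (Ioo 0 1)) (h : IsDirichletMode g lam v w)
    (h' : IsDirichletMode g mu y z) (hne : lam ≠ mu) : ∫ x in (0 : ℝ)..1, v x * y x = 0 := by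
  have h1 := integral_deriv_mul_deriv hg h h'
  have h2 := integral_deriv_mul_deriv hg h' h
  simp only [mul_comm (z _), mul_comm (y _)] at h2
  have h3 : (lam - mu) * ∫ x in (0 : ℝ)..1, v x * y x = 0 := by linarith
  exact (mul_eq_zero.1 h3).resolve_left (sub_ne_zero.2 hne)

end IsDirichletMode

/-- Passage from the distributional definition to a classical one: `w` is the continuous
representative of `v'`, its primitive `u` agrees with `v` on `[0, 1]`, and the result is normalised
in `L²`. -/
theorem exists_isDirichletMode {g : ℝ → ℝ} {lam : ℝ} (hlam : lam ∈ dirichletEigenvalues g) :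
    ∃ v w, IsDirichletMode g lam v w ∧ ∫ x in (0 : ℝ)..1, v x * v x = 1 := by
  obtain ⟨v, v'', ⟨hvc, hv0, hv1, hv''m, v', hv'm, hvv', hv'v''⟩, ⟨x₀, hx₀, hvx₀⟩, heq⟩ := hlam
  have hv' : IntegrableOn v' (Ioo 0 1) := hv'm.integrable one_le_two
  have hv'' : IntegrableOn v'' (Ioo 0 1) := hv''m.integrable one_le_two
  have hv''I : IntervalIntegrable v'' volume 0 1 := by
    rwa [intervalIntegrable_iff_integrableOn_Ioo_of_le zero_le_one]
  have hv : IntegrableOn v (Ioo 0 1) := hvc.integrableOn_Icc.mono_set Ioo_subset_Icc_self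
  obtain ⟨C, hC⟩ := hvv'.ae_eq_const_add_integral hv hv'
  obtain ⟨D, hD⟩ := hv'v''.ae_eq_const_add_integral hv' hv''
  set w : ℝ → ℝ := fun x => D + ∫ t in (0 : ℝ)..x, v'' t with hw
  have hone : ∀ᵐ x : ℝ, x ≠ 1 := by simp [ae_iff, measure_singleton]
  have hzero : ∀ᵐ x : ℝ, x ≠ 0 := by simp [ae_iff, measure_singleton]
  have hwac : AbsolutelyContinuousOnInterval w 0 1 := by
    have hcst : AbsolutelyContinuousOnInterval (fun _ : ℝ => D) 0 1 :=
      (contDiff_const (n := 1)).contDiffOn.absolutelyContinuousOnInterval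
    exact hcst.fun_add (hv''I.absolutelyContinuousOnInterval_intervalIntegral (by simp))
  have hwI : IntervalIntegrable w volume 0 1 := hwac.continuousOn.intervalIntegrable
  set u : ℝ → ℝ := fun x => ∫ t in (0 : ℝ)..x, w t with hu
  have huac : AbsolutelyContinuousOnInterval u 0 1 :=
    hwI.absolutelyContinuousOnInterval_intervalIntegral (by simp)
  have huc : ContinuousOn u (Icc 0 1) := by simpa using huac.continuousOn
  have hu' : ∀ x ∈ Icc (0 : ℝ) 1, ∫ t in (0 : ℝ)..x, v' t = u x := by
    intro x hx
    refine intervalIntegral.integral_congr_ae ?_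
    filter_upwards [hD, hone] with t ht ht1 htx
    rw [uIoc_of_le hx.1] at htx
    exact ht ⟨htx.1, lt_of_le_of_ne (htx.2.trans hx.2) ht1⟩
  have hvu : EqOn v (fun x => C + u x) (Icc 0 1) := by
    refine Measure.eqOn_Icc_of_ae_eq volume zero_ne_one ?_ hvc (continuousOn_const.add huc)
    refine (ae_restrict_iff' measurableSet_Icc).2 ?_
    filter_upwards [hC, hone, hzero] with x hx h1 h0 hxI
    rw [hx ⟨lt_of_le_of_ne hxI.1 h0.symm, lt_of_le_of_ne hxI.2 h1⟩, hu' x hxI]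
  -- Continuity up to the endpoint lets the boundary value at 0 fix the constant.
  have hC0 : C = 0 := by
    have := hvu (show (0 : ℝ) ∈ Icc 0 1 by simp)
    simpa [hu, hv0] using this.symm
  have hvu' : EqOn v u (Icc 0 1) := fun x hx => by simpa [hC0] using hvu hx
  have hmode : IsDirichletMode g lam u w :=
    { ac_fun := huac
      ac_deriv := hwac
      zero_left := by simp [hu]
      zero_right := by rw [← hvu' (by simp), hv1]
      deriv_fun := by
        filter_upwards [hwI.ae_hasDerivAt_integral] with x hx hx'
        exact (hx (uIoc_subset_uIcc hx') 0 (by simp)).deriv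
      deriv_deriv := by
        filter_upwards [hv''I.ae_hasDerivAt_integral, (ae_restrict_iff' measurableSet_Ioo).1 heq,
          hone] with x hx hxe hx1 hx'
        rw [((hx (uIoc_subset_uIcc hx') 0 (by simp)).const_add D).deriv]
        rw [uIoc_of_le zero_le_one] at hx'
        have := hxe ⟨hx'.1, lt_of_le_of_ne hx'.2 hx1⟩
        rw [hvu' (Ioc_subset_Icc_self hx')] at this
        linarith }
  have hpos : 0 < ∫ x in (0 : ℝ)..1, u x * u x := by
    refine intervalIntegral.integral_pos zero_lt_one (huc.mul huc)
      (fun x _ => mul_self_nonneg _) ⟨x₀, hx₀, ?_⟩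
    exact mul_self_pos.2 (by rwa [← hvu' hx₀])
  set m := ∫ x in (0 : ℝ)..1, u x * u x with hm
  refine ⟨_, _, hmode.const_mul (Real.sqrt m)⁻¹, ?_⟩
  have : (fun x => (Real.sqrt m)⁻¹ * u x * ((Real.sqrt m)⁻¹ * u x)) =
      fun x => m⁻¹ * (u x * u x) := by
    ext x
    have h1 : (Real.sqrt m)⁻¹ * (Real.sqrt m)⁻¹ = m⁻¹ := by
      rw [← mul_inv, Real.mul_self_sqrt hpos.le]
    rw [← h1]
    ring
  rw [this, intervalIntegral.integral_const_mul, ← hm, inv_mul_cancel₀ hpos.ne']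

/-! ### Counting eigenvalues. -/

/-- Cauchy–Schwarz on an interval of length at most 1, obtained by expanding `∫ (W - m)² ≥ 0`. -/
theorem sq_integral_le_integral_sq {W : ℝ → ℝ} (hW : ContinuousOn W (Icc 0 1)) {x : ℝ}
    (hx : x ∈ Icc (0 : ℝ) 1) : (∫ t in (0 : ℝ)..x, W t) ^ 2 ≤ ∫ t in (0 : ℝ)..1, W t ^ 2 := by
  have hWx : ContinuousOn W (uIcc 0 x) := by
    rw [uIcc_of_le hx.1]
    exact hW.mono (Icc_subset_Icc_right hx.2)
  set m := ∫ t in (0 : ℝ)..x, W t with hm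
  have h1 : 0 ≤ ∫ t in (0 : ℝ)..x, (W t - m) ^ 2 :=
    intervalIntegral.integral_nonneg hx.1 fun t _ => sq_nonneg _
  have h2 : ∫ t in (0 : ℝ)..x, (W t - m) ^ 2 = (∫ t in (0 : ℝ)..x, W t ^ 2) - 2 * m * m +
      x * m ^ 2 := by
    have : (fun t => (W t - m) ^ 2) = fun t => W t ^ 2 - 2 * m * W t + m ^ 2 := by
      ext t; ring
    rw [this, intervalIntegral.integral_add, intervalIntegral.integral_sub,
      intervalIntegral.integral_const_mul, ← hm, intervalIntegral.integral_const, smul_eq_mul,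
      sub_zero]
    · exact (hWx.pow 2).intervalIntegrable
    · exact hWx.intervalIntegrable.const_mul _
    · exact ((hWx.pow 2).intervalIntegrable).sub (hWx.intervalIntegrable.const_mul _)
    · exact intervalIntegrable_const
  have h3 : ∫ t in (0 : ℝ)..x, W t ^ 2 ≤ ∫ t in (0 : ℝ)..1, W t ^ 2 := by
    refine intervalIntegral.integral_mono_interval le_rfl hx.1 hx.2
      (Filter.Eventually.of_forall fun t => sq_nonneg _) ?_
    refine ContinuousOn.intervalIntegrable ?_
    rw [uIcc_of_le zero_le_one]
    exact hW.pow 2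
  nlinarith [mul_nonneg (sub_nonneg.2 hx.2) (sq_nonneg m)]

theorem IntervalIntegrable.finset_sum_apply {ι : Type*} {S : Finset ι} {F : ι → ℝ → ℝ} {a b : ℝ}
    (h : ∀ i ∈ S, IntervalIntegrable (F i) volume a b) :
    IntervalIntegrable (fun x => ∑ i ∈ S, F i x) volume a b := by
  simpa only [Finset.sum_fn] using IntervalIntegrable.sum S h

theorem integral_finset_sum_sum_mul {ι : Type*} {S : Finset ι} {F : ι → ι → ℝ → ℝ} {a b : ℝ}
    (c : ι → ℝ) (h : ∀ i ∈ S, ∀ j ∈ S, IntervalIntegrable (F i j) volume a b) :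
    ∫ x in a..b, ∑ i ∈ S, ∑ j ∈ S, c i * c j * F i j x =
      ∑ i ∈ S, ∑ j ∈ S, c i * c j * ∫ x in a..b, F i j x := by
  rw [intervalIntegral.integral_finsetSum fun i hi =>
    IntervalIntegrable.finset_sum_apply fun j hj => (h i hi j hj).const_mul (c i * c j)]
  refine Finset.sum_congr rfl fun i hi => ?_
  rw [intervalIntegral.integral_finsetSum fun j hj => (h i hi j hj).const_mul (c i * c j)]
  simp_rw [intervalIntegral.integral_const_mul]

/-- The eigenvalue counting function is bounded by `Λ`. -/
theorem card_le_of_subset_dirichletEigenvalues {g : ℝ → ℝ} (hg : IntegrableOn g (Ioo 0 1))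
    (hg0 : ∀ᵐ x ∂(volume.restrict (Ioo (0 : ℝ) 1)), 0 ≤ g x) {S : Finset ℝ} {Λ : ℝ}
    (hS : ∀ lam ∈ S, lam ∈ dirichletEigenvalues g) (hΛ : ∀ lam ∈ S, lam ≤ Λ) :
    (S.card : ℝ) ≤ Λ ∨ S = ∅ := by
  -- For empty `S` the number `Λ` may be negative, so this case is kept apart.
  rcases S.eq_empty_or_nonempty with hSe | ⟨lam₀, hlam₀⟩
  · exact Or.inr hSe
  left
  have hgI : IntervalIntegrable g volume 0 1 := by
    rwa [intervalIntegrable_iff_integrableOn_Ioo_of_le zero_le_one]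
  have hex : ∀ lam : ℝ, ∃ v w, lam ∈ S → IsDirichletMode g lam v w ∧
      ∫ x in (0 : ℝ)..1, v x * v x = 1 := by
    intro lam
    by_cases h : lam ∈ S
    · obtain ⟨v, w, hvw⟩ := exists_isDirichletMode (hS lam h)
      exact ⟨v, w, fun _ => hvw⟩
    · exact ⟨0, 0, fun h' => absurd h' h⟩
  choose v w hvw using hex
  have hvc : ∀ i ∈ S, ContinuousOn (v i) (uIcc 0 1) := fun i hi => by
    simpa using (hvw i hi).1.continuousOn_fun
  have hwc : ∀ i ∈ S, ContinuousOn (w i) (uIcc 0 1) := fun i hi => by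
    simpa using (hvw i hi).1.continuousOn_deriv
  have horth : ∀ i ∈ S, ∀ j ∈ S, ∫ x in (0 : ℝ)..1, v i x * v j x = if i = j then 1 else 0 := by
    intro i hi j hj
    split_ifs with hij
    · subst hij
      exact (hvw i hi).2
    · exact IsDirichletMode.integral_mul_eq_zero hg (hvw i hi).1 (hvw j hj).1 hij
  -- Orthonormality makes the energy equal to `∑ lam c² - ∫ g (∑ c v)²`, and the last term is
  -- dropped because `g ≥ 0`.
  have henergy : ∀ c : ℝ → ℝ, ∫ x in (0 : ℝ)..1, (∑ i ∈ S, c i * w i x) ^ 2 ≤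
      Λ * ∑ i ∈ S, c i ^ 2 := by
    intro c
    have h1 : ∫ x in (0 : ℝ)..1, (∑ i ∈ S, c i * w i x) ^ 2 =
        ∑ i ∈ S, ∑ j ∈ S, c i * c j * ∫ x in (0 : ℝ)..1, w i x * w j x := by
      have : (fun x => (∑ i ∈ S, c i * w i x) ^ 2) =
          fun x => ∑ i ∈ S, ∑ j ∈ S, c i * c j * (w i x * w j x) := by
        ext x
        rw [sq, Finset.sum_mul_sum]
        refine Finset.sum_congr rfl fun i _ => Finset.sum_congr rfl fun j _ => by ring
      rw [this]
      exact integral_finset_sum_sum_mul c fun i hi j hj =>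
        ((hwc i hi).mul (hwc j hj)).intervalIntegrable
    have h2 : ∫ x in (0 : ℝ)..1, g x * (∑ i ∈ S, c i * v i x) ^ 2 =
        ∑ i ∈ S, ∑ j ∈ S, c i * c j * ∫ x in (0 : ℝ)..1, g x * (v i x * v j x) := by
      have : (fun x => g x * (∑ i ∈ S, c i * v i x) ^ 2) =
          fun x => ∑ i ∈ S, ∑ j ∈ S, c i * c j * (g x * (v i x * v j x)) := by
        ext x
        rw [sq, Finset.sum_mul_sum, Finset.mul_sum]
        refine Finset.sum_congr rfl fun i _ => ?_
        rw [Finset.mul_sum]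
        refine Finset.sum_congr rfl fun j _ => by ring
      rw [this]
      exact integral_finset_sum_sum_mul c fun i hi j hj =>
        hgI.mul_continuousOn ((hvc i hi).mul (hvc j hj))
    have h3 : 0 ≤ ∫ x in (0 : ℝ)..1, g x * (∑ i ∈ S, c i * v i x) ^ 2 := by
      rw [intervalIntegral.integral_of_le zero_le_one, integral_Ioc_eq_integral_Ioo]
      refine integral_nonneg_of_ae ?_
      filter_upwards [hg0] with x hx
      exact mul_nonneg hx (sq_nonneg _)
    have h4 : ∑ i ∈ S, ∑ j ∈ S, c i * c j * ∫ x in (0 : ℝ)..1, w i x * w j x =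
        (∑ i ∈ S, i * c i ^ 2) -
          ∑ i ∈ S, ∑ j ∈ S, c i * c j * ∫ x in (0 : ℝ)..1, g x * (v i x * v j x) := by
      rw [← Finset.sum_sub_distrib]
      refine Finset.sum_congr rfl fun i hi => ?_
      have : ∀ j ∈ S, c i * c j * ∫ x in (0 : ℝ)..1, w i x * w j x =
          (if i = j then j * c j ^ 2 else 0) -
            c i * c j * ∫ x in (0 : ℝ)..1, g x * (v i x * v j x) := by
        intro j hj
        rw [IsDirichletMode.integral_deriv_mul_deriv hg (hvw i hi).1 (hvw j hj).1, horth i hi j hj]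
        split_ifs with hij
        · subst hij; ring
        · ring
      rw [Finset.sum_congr rfl this, Finset.sum_sub_distrib, Finset.sum_ite_eq, if_pos hi]
    rw [h1, h4, ← h2]
    have h5 : ∑ i ∈ S, i * c i ^ 2 ≤ Λ * ∑ i ∈ S, c i ^ 2 := by
      rw [Finset.mul_sum]
      exact Finset.sum_le_sum fun i hi => mul_le_mul_of_nonneg_right (hΛ i hi) (sq_nonneg _)
    linarith
  have hpt : ∀ x ∈ Icc (0 : ℝ) 1, ∑ i ∈ S, v i x * v i x ≤ max Λ 0 := by
    intro x hx
    -- With these coefficients `σ = ∑ v_i(x)²` is itself `∫₀ˣ ∑ c_i w_i`, so `σ² ≤ Λ σ`, giving `σ ≤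
    -- max Λ 0`. Integrating over `x` then bounds the cardinality.
    set c : ℝ → ℝ := fun i => v i x with hc
    have hWc : ContinuousOn (fun t => ∑ i ∈ S, c i * w i t) (Icc 0 1) := by
      refine continuousOn_finsetSum _ fun i hi => continuousOn_const.mul ?_
      simpa using hwc i hi
    have h1 : ∑ i ∈ S, v i x * v i x = ∫ t in (0 : ℝ)..x, ∑ i ∈ S, c i * w i t := by
      rw [intervalIntegral.integral_finsetSum]
      · refine Finset.sum_congr rfl fun i hi => ?_
        rw [intervalIntegral.integral_const_mul, ← (hvw i hi).1.apply_eq_integral hx]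
      · intro i hi
        refine (ContinuousOn.intervalIntegrable ?_).const_mul _
        refine (hwc i hi).mono ?_
        rw [uIcc_of_le hx.1, uIcc_of_le zero_le_one]
        exact Icc_subset_Icc_right hx.2
    have h2 := (sq_integral_le_integral_sq hWc hx).trans (henergy c)
    rw [← h1] at h2
    have h3 : ∑ i ∈ S, c i ^ 2 = ∑ i ∈ S, v i x * v i x :=
      Finset.sum_congr rfl fun i _ => by rw [sq]
    rw [h3] at h2
    set σ := ∑ i ∈ S, v i x * v i x with hσ
    by_contra hlt
    rw [not_le, max_lt_iff] at hlt
    nlinarith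
  have hcard : (S.card : ℝ) ≤ max Λ 0 := by
    have hI : ∀ i ∈ S, IntervalIntegrable (fun x => v i x * v i x) volume 0 1 :=
      fun i hi => ((hvc i hi).mul (hvc i hi)).intervalIntegrable
    have h1 : ∫ x in (0 : ℝ)..1, ∑ i ∈ S, v i x * v i x = S.card := by
      rw [intervalIntegral.integral_finsetSum hI,
        Finset.sum_congr rfl fun i hi => (hvw i hi).2]
      simp
    have h2 : ∫ x in (0 : ℝ)..1, ∑ i ∈ S, v i x * v i x ≤ ∫ _ in (0 : ℝ)..1, max Λ 0 := by
      exact intervalIntegral.integral_mono_on zero_le_one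
        (IntervalIntegrable.finset_sum_apply hI) intervalIntegrable_const hpt
    rw [h1] at h2
    simpa using h2
  have hcpos : (1 : ℝ) ≤ S.card := by
    exact_mod_cast Finset.card_pos.2 ⟨lam₀, hlam₀⟩
  rcases le_max_iff.1 hcard with h | h
  · exact h
  · linarith

/-- The counting bound for a single eigenvalue, with `Λ` equal to that eigenvalue. -/
theorem one_le_of_mem_dirichletEigenvalues {g : ℝ → ℝ} (hg : IntegrableOn g (Ioo 0 1))
    (hg0 : ∀ᵐ x ∂(volume.restrict (Ioo (0 : ℝ) 1)), 0 ≤ g x) {lam : ℝ}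
    (h : lam ∈ dirichletEigenvalues g) : 1 ≤ lam := by
  have := card_le_of_subset_dirichletEigenvalues hg hg0 (S := {lam}) (Λ := lam) (by simpa)
    (by simp)
  simpa using this

theorem finite_dirichletEigenvalues_inter_Iic {g : ℝ → ℝ} (hg : IntegrableOn g (Ioo 0 1))
    (hg0 : ∀ᵐ x ∂(volume.restrict (Ioo (0 : ℝ) 1)), 0 ≤ g x) (Λ : ℝ) :
    (dirichletEigenvalues g ∩ Iic Λ).Finite := by
  by_contra hinf
  obtain ⟨n, hn⟩ := exists_nat_gt Λ
  obtain ⟨S, hS, hcard⟩ := Set.Infinite.exists_subset_card_eq hinf (n + 1)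
  rcases card_le_of_subset_dirichletEigenvalues hg hg0 (S := S) (Λ := Λ)
    (fun lam h => (hS h).1) (fun lam h => (hS h).2) with h | h
  · rw [hcard] at h
    push_cast at h
    linarith
  · rw [h] at hcard
    simp at hcard

/-! ### Behaviour of `deltaTilde` and the conclusion. -/

-- With `x = lam p^β`, the second summand is `p p^{-β} · x E_{β,2}(-x)`, whose limit is the leading
-- coefficient; the first summand decays.
open Filter Topology in
theorem tendsto_waveTerm_atTop {β p : ℝ} (hβ1 : 1 < β) (hβ2 : β < 2) (hp : 0 < p) :
    Tendsto (fun lam : ℝ => mittagLeffler β 1 (-lam * p ^ β) +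
      lam * p * mittagLeffler β 2 (-lam * p ^ β)) atTop
      (𝓝 (p * (p ^ β)⁻¹ * (Real.Gamma (2 - β))⁻¹)) := by
  have hpβ : 0 < p ^ β := Real.rpow_pos_of_pos hp β
  have hx : Tendsto (fun lam : ℝ => lam * p ^ β) atTop atTop := tendsto_id.atTop_mul_const hpβ
  have h1 := (tendsto_mittagLeffler_neg_atTop (b := 1) (by linarith : 0 < β) hβ2 one_pos).comp hx
  have h2 := ((tendsto_mul_mittagLeffler_neg_atTop (b := 2) (by linarith : 0 < β) hβ2 hβ2).comp
    hx).const_mul (p * (p ^ β)⁻¹)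
  have h3 := h1.add h2
  rw [zero_add] at h3
  refine h3.congr fun lam => ?_
  simp only [Function.comp_apply, neg_mul]
  field_simp

open Filter Topology in
theorem eventually_deltaTilde_ne_zero {α : ℝ} (β p : ℝ) {lam : ℝ} (hα0 : 0 < α) (hα1 : α < 1)
    (hlam : 0 < lam) : ∀ᶠ q in atTop, deltaTilde α β p q lam ≠ 0 := by
  have hx : Tendsto (fun q : ℝ => lam * q ^ α) atTop atTop :=
    (tendsto_rpow_atTop hα0).const_mul_atTop hlam
  have h0 := (tendsto_mittagLeffler_neg_atTop (b := 1) hα0 (by linarith) one_pos).comp hx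
  set f := mittagLeffler β 1 (-lam * p ^ β) + lam * p * mittagLeffler β 2 (-lam * p ^ β) with hf
  -- The wave term `f` does not depend on `q`. If it vanishes, decay alone is not enough and the
  -- nonzero limit of `x E_{α,1}(-x)` is used.
  by_cases hf0 : f = 0
  · have h1 := (tendsto_mul_mittagLeffler_neg_atTop hα0 (by linarith) hα1).comp hx
    have hΓ : (Real.Gamma (1 - α))⁻¹ ≠ 0 :=
      inv_ne_zero (Real.Gamma_pos_of_pos (by linarith)).ne'
    filter_upwards [h1.eventually_ne hΓ] with q hq
    rw [deltaTilde, ← hf, hf0, sub_zero, neg_mul]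
    exact right_ne_zero_of_mul hq
  · filter_upwards [h0.eventually_ne (Ne.symm hf0)] with q hq
    rw [deltaTilde, ← hf, neg_mul]
    exact sub_ne_zero.2 hq

theorem lemma4p1 (α β : ℝ) (hα0 : 0 < α) (hα1 : α < 1) (hβ1 : 1 < β) (hβ2 : β < 2)
    (g : ℝ → ℝ) (hg : MemLp g ⊤ (volume.restrict (Ioo (0 : ℝ) 1)))
    (hg0 : ∀ᵐ x ∂(volume.restrict (Ioo (0 : ℝ) 1)), 0 ≤ g x)
    (p : ℝ) (hp : 0 < p) :
    ∃ Q : ℝ, 0 < Q ∧ ∀ q : ℝ, Q ≤ q →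
      ∃ δ : ℝ, 0 < δ ∧ ∀ lam ∈ dirichletEigenvalues g, δ < |deltaTilde α β p q lam| := by
  have hgi : IntegrableOn g (Ioo 0 1) := hg.integrable le_top
  set M : ℝ := p * (p ^ β)⁻¹ * (Real.Gamma (2 - β))⁻¹ with hM
  have hMpos : 0 < M := by
    have := Real.Gamma_pos_of_pos (show 0 < 2 - β by linarith)
    positivity
  -- Beyond `Λ` the wave term exceeds `M / 2`; beyond `Y` the `α`-term is below `M / 4`. The gap
  -- left over is `M / 4`.
  obtain ⟨Λ, hΛ⟩ := Filter.eventually_atTop.1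
    ((tendsto_waveTerm_atTop hβ1 hβ2 hp).eventually_const_lt (half_lt_self hMpos))
  obtain ⟨Y, hY⟩ := Filter.eventually_atTop.1
    ((tendsto_mittagLeffler_neg_atTop (b := 1) hα0 (by linarith) one_pos).eventually_lt_const
      (show (0 : ℝ) < M / 4 by positivity))
  set T := dirichletEigenvalues g ∩ Iic Λ with hT
  have hTfin : T.Finite := finite_dirichletEigenvalues_inter_Iic hgi hg0 Λ
  have hone : ∀ lam ∈ dirichletEigenvalues g, 1 ≤ lam := fun lam h =>
    one_le_of_mem_dirichletEigenvalues hgi hg0 h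
  have hev : ∀ᶠ q in Filter.atTop, ∀ lam ∈ T, deltaTilde α β p q lam ≠ 0 :=
    (Filter.eventually_all_finite hTfin).2 fun lam h =>
      eventually_deltaTilde_ne_zero β p hα0 hα1 (by linarith [hone lam h.1])
  obtain ⟨Q, hQ⟩ := Filter.eventually_atTop.1
    (hev.and ((tendsto_rpow_atTop hα0).eventually_ge_atTop Y))
  refine ⟨max Q 1, by positivity, fun q hq => ?_⟩
  obtain ⟨hq1, hq2⟩ := hQ q ((le_max_left _ _).trans hq)
  have hq0 : 0 < q := lt_of_lt_of_le one_pos ((le_max_right _ _).trans hq)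
  have hsmall : ∃ δ : ℝ, 0 < δ ∧ ∀ lam ∈ T, δ < |deltaTilde α β p q lam| := by
    rcases T.eq_empty_or_nonempty with hTe | hTne
    · exact ⟨1, one_pos, by simp [hTe]⟩
    · obtain ⟨l₀, hl₀, hmin⟩ := Set.exists_min_image T (fun l => |deltaTilde α β p q l|) hTfin hTne
      have hpos : 0 < |deltaTilde α β p q l₀| := abs_pos.2 (hq1 l₀ hl₀)
      -- Half of the minimum, since the inequality must be strict.
      exact ⟨|deltaTilde α β p q l₀| / 2, by positivity, fun l hl =>
        (half_lt_self hpos).trans_le (hmin l hl)⟩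
  obtain ⟨δ, hδ, hδT⟩ := hsmall
  refine ⟨min δ (M / 4), by positivity, fun lam hlam => ?_⟩
  by_cases hl : lam ≤ Λ
  · exact (min_le_left _ _).trans_lt (hδT lam ⟨hlam, hl⟩)
  · refine (min_le_right _ _).trans_lt ?_
    have h1 := hΛ lam (not_le.1 hl).le
    have hqα : 0 ≤ q ^ α := by positivity
    -- `lam ≥ 1` gives `lam q^α ≥ q^α ≥ Y`, so the threshold on `q` serves all eigenvalues at once.
    have h2 := hY (lam * q ^ α) (by nlinarith [hone lam hlam])
    rw [lt_abs, deltaTilde, neg_mul lam (q ^ α)]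
    right
    linarith
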